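/- Let $G$ be a finite group with identity $e$, and let $\mathrm{Irr}(G)$ be its set of irreducible complex characters. A supercharacter theory of $G$ is a pair $(\mathcal X,\mathcal K)$, where $\mathcal X$ is a partition of $\mathrm{Irr}(G)$ and $\mathcal K$ is a partition of $G$ into unions of conjugacy classes, such that $\{e\}\in\mathcal K$, the singleton of the trivial character belongs to $\mathcal X$, $|\mathcal X|=|\mathcal K|$, and for every $X\in\mathcal X$ the supercharacter $\sigma_X=\sum_{\chi\in X}\chi(e)\chi$ is constant on every superclass $K\in\mathcal K$. Its supercharacter table is the matrix with rows indexed by $\mathcal X$, columns indexed by $\mathcal K$, and $(X,K)$ entry the value of $\sigma_X$ on $K$. Its associated algebra is the linear span in $\mathbb C G$ of the elements $\widehat K=\sum_{g\in K}g$, $K\in\mathcal K$; it is closed under the ordinary product of $\mathbb C G$ and under the Hadamard product $\left(\sum_g a_g g\right)\circ\left(\sum_g b_g g\right)=\sum_g a_gb_g\,g$. Let $A$ be a supercharacter theory of a finite group $G$ and $B$ a supercharacter theory of a finite group $H$, and denote their associated algebras by the same letters. An isomorphism of supercharacter theories is a bijective $\mathbb C$-linear map $\phi:A\to B$ with $\phi(xy)=\phi(x)\phi(y)$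 and $\phi(x\circ y)=\phi(x)\circ\phi(y)$ for all $x,y\in A$. **Theorem.** There is an isomorphism of supercharacter theories $\phi:A\to B$ if and only if the supercharacter tables of $A$ and $B$ are identical up to reordering of rows and columns; that is, if and only if there are bijections $r:\mathcal X_A\to\mathcal X_B$ and $c:\mathcal K_A\to\mathcal K_B$ such that, for all $X\in\mathcal X_A$ and $K\in\mathcal K_A$, the $(X,K)$ entry of the table of $A$ equals the $(r(X),c(K))$ entry of the table of $B$. -/

import Mathlib

open scoped MonoidAlgebra

universe u v

noncomputable section

/-- `χ` is an irreducible complex character of `G`: the trace function of an irreducible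
finite-dimensional complex representation. (Every such representation is isomorphic to one
on a space living in `Type`.) -/
def IsIrrChar (G : Type u) [Group G] (χ : G → ℂ) : Prop :=
  ∃ (V : Type) (_ : AddCommGroup V) (_ : Module ℂ V) (_ : FiniteDimensional ℂ V)
    (ρ : Representation ℂ G V), ρ.IsIrreducible ∧ ρ.character = χ

/-- The set `Irr(G)` of irreducible complex characters of `G`, as a type. -/
abbrev Irr (G : Type u) [Group G] : Type u := {χ : G → ℂ // IsIrrChar G χ}

/-- The Hadamard (coefficientwise) product on the group algebra `ℂ[G]`. -/
def hadamardProd {G : Type u} (x y : ℂ[G]) : ℂ[G] :=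
  .ofCoeff (Finsupp.zipWith (fun a b : ℂ => a * b) (mul_zero 0) x.coeff y.coeff)

/-- The sum `∑_{g ∈ K} g`, in the group algebra, of the elements of a subset `K` of `G`. -/
def setSum {G : Type u} [Finite G] (K : Set G) : ℂ[G] :=
  ∑ g ∈ K.toFinite.toFinset, MonoidAlgebra.single g (1 : ℂ)

theorem coeff_hadamardProd {G : Type u} (x y : ℂ[G]) (g : G) :
    (hadamardProd x y).coeff g = x.coeff g * y.coeff g := by
  simp [hadamardProd]

open Classical in
theorem coeff_setSum {G : Type u} [Finite G] (K : Set G) (g : G) :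
    (setSum K).coeff g = if g ∈ K then 1 else 0 := by
  simp [setSum, MonoidAlgebra.coeff_sum, Finsupp.single_apply, Finsupp.finsetSum_apply]

section Characters

variable {G : Type u} [Group G]

/-- The character of the trivial representation. -/
def trivIrr (G : Type u) [Group G] : Irr G :=
  ⟨fun _ => 1, ℂ, inferInstance, inferInstance, inferInstance, Representation.trivial ℂ G ℂ, by
    have key : ∀ σ : Subrepresentation (Representation.trivial ℂ G ℂ),
        σ = ⊥ ∨ σ = ⊤ := fun σ =>
      (eq_bot_or_eq_top σ.toSubmodule).imp
        (fun h => Subrepresentation.toSubmodule_injective h)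
        (fun h => Subrepresentation.toSubmodule_injective h)
    have hne : (⊥ : Subrepresentation (Representation.trivial ℂ G ℂ)) ≠ ⊤ :=
      fun h => bot_ne_top (α := Submodule ℂ ℂ)
        (congrArg Subrepresentation.toSubmodule h)
    exact { exists_pair_ne := ⟨_, _, hne⟩, eq_bot_or_eq_top := key }, by
    funext g
    simp [Representation.character]⟩

theorem IsIrrChar.conj {χ : G → ℂ} (hχ : IsIrrChar G χ) (g h : G) :
    χ (h * g * h⁻¹) = χ g := by
  obtain ⟨V, _, _, _, ρ, -, rfl⟩ := hχ
  exact Representation.char_conj ρ g h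

theorem IsIrrChar.exists_nat {χ : G → ℂ} (hχ : IsIrrChar G χ) :
    ∃ n : ℕ, 0 < n ∧ χ 1 = n := by
  obtain ⟨V, _, _, _, ρ, hρ, rfl⟩ := hχ
  refine ⟨Module.finrank ℂ V, ?_, Representation.char_one ρ⟩
  by_contra h0
  have h0 : Module.finrank ℂ V = 0 := by omega
  have : Subsingleton V := Module.finrank_zero_iff.1 h0
  exact bot_ne_top (α := Subrepresentation ρ)
    (Subrepresentation.toSubmodule_injective (Subsingleton.elim _ _))

theorem exists_scalar [Fintype G] {V : Type} [AddCommGroup V] [Module ℂ V]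
    [FiniteDimensional ℂ V] (τ : Representation ℂ G V) (hτ : τ.IsIrreducible) (χ : G → ℂ)
    (hχ : ∀ g h, χ (h * g * h⁻¹) = χ g) :
    ∃ c : ℂ, (∑ h, χ h • τ h⁻¹) = c • (1 : Module.End ℂ V) := by
  have hcomm : ∀ g : G, (∑ h, χ h • τ h⁻¹) ∘ₗ τ g = τ g ∘ₗ (∑ h, χ h • τ h⁻¹) := by
    intro g
    change (∑ h, χ h • τ h⁻¹) * τ g = τ g * (∑ h, χ h • τ h⁻¹)
    rw [Finset.sum_mul, Finset.mul_sum]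
    refine Fintype.sum_equiv (MulAut.conj g⁻¹).toEquiv _ _ fun h => ?_
    have h1 : χ (g⁻¹ * h * g) = χ h := by simpa using hχ h g⁻¹
    simp [← map_mul, mul_assoc, ← h1]
  let f : Representation.IntertwiningMap τ τ := ⟨∑ h, χ h • τ h⁻¹, hcomm⟩
  obtain ⟨c, hc⟩ :=
    (Representation.IsIrreducible.algebraMap_intertwiningMap_bijective_of_isAlgClosed
      (ρ := τ)).2 f
  refine ⟨c, ?_⟩
  have := congrArg (fun F => F.toLinearMap) hc
  exact this.symm

open Classical in
/-- Convolution of irreducible characters. -/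
theorem irr_convolution [Fintype G] (χ ψ : Irr G) (g : G) :
    ∑ h, χ.1 h * ψ.1 (h⁻¹ * g) = if χ = ψ then (Nat.card G : ℂ) / χ.1 1 * χ.1 g else 0 := by
  have hcard : (Nat.card G : ℂ) ≠ 0 := by exact_mod_cast Nat.card_pos.ne'
  let _ : Invertible (Nat.card G : ℂ) := invertibleOfNonzero hcard
  obtain ⟨n, hn, hψ1⟩ := ψ.2.exists_nat
  have hn' : (n : ℂ) ≠ 0 := by exact_mod_cast hn.ne'
  obtain ⟨χ, hχ⟩ := χ
  obtain ⟨ψ, hψ⟩ := ψ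
  have hclass := hχ.conj
  obtain ⟨W, _, _, _, τ, hτ, rfl⟩ := hψ
  obtain ⟨c, hc⟩ := exists_scalar τ hτ χ hclass
  have hconv : ∀ g, ∑ h, χ h * τ.character (h⁻¹ * g) = c * τ.character g := by
    intro g
    have := congrArg (fun T => LinearMap.trace ℂ W (T * τ g)) hc
    simpa [Finset.sum_mul, Representation.character, map_mul, ← Representation.char_mul_comm]
      using this
  have h1 := hconv 1
  simp only [mul_one] at h1
  rw [hconv]
  change τ.character 1 = n at hψ1
  change _ = ite _ (Nat.card G / χ 1 * χ g) 0
  rw [hψ1] at h1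
  split_ifs with h
  · obtain rfl : χ = τ.character := congrArg Subtype.val h
    have ho := Representation.char_orthonormal τ τ
    rw [if_pos ⟨Representation.Equiv.refl τ⟩, h1] at ho
    rw [hψ1]
    field_simp at ho ⊢
    rw [ho]
  · obtain ⟨V, _, _, _, ρ, hρ, rfl⟩ := hχ
    have ho := Representation.char_orthonormal ρ τ
    rw [if_neg (fun ⟨e⟩ => h (Subtype.ext (Representation.char_iso e).symm)), h1] at ho
    have : c = 0 := by
      simpa [hcard, hn'] using ho
    simp [this]

/-- The element `∑_g f(g) g` of the group algebra. -/
def funToAlg [Finite G] : (G → ℂ) →ₗ[ℂ] ℂ[G] where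
  toFun f := .ofCoeff (Finsupp.equivFunOnFinite.symm f)
  map_add' f g := by ext; simp
  map_smul' c f := by ext; simp

theorem coeff_funToAlg {G : Type u} [Finite G] (f : G → ℂ) (g : G) : (funToAlg f).coeff g = f g := rfl

theorem coeff_funToAlg_mul [Fintype G] (f f' : G → ℂ) (g : G) :
    (funToAlg f * funToAlg f').coeff g = ∑ h, f h * f' (h⁻¹ * g) := by
  rw [MonoidAlgebra.coeff_mul_apply_left, Finsupp.sum_fintype]
  · rfl
  · simp

/-- The element `(χ(1)/|G|) ∑_g χ(g) g`: the central idempotent of the conjugate of `χ`. -/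
def irrElt [Finite G] (χ : Irr G) : ℂ[G] :=
  (χ.1 1 / Nat.card G) • funToAlg χ.1

open Classical in
theorem irrElt_mul [Finite G] (χ ψ : Irr G) :
    irrElt χ * irrElt ψ = if χ = ψ then irrElt χ else 0 := by
  cases nonempty_fintype G
  have hcard : (Nat.card G : ℂ) ≠ 0 := by exact_mod_cast Nat.card_pos.ne'
  obtain ⟨n, hn, hχ1⟩ := χ.2.exists_nat
  have hn' : (n : ℂ) ≠ 0 := by exact_mod_cast hn.ne'
  ext g
  rw [irrElt, irrElt, smul_mul_smul_comm, MonoidAlgebra.coeff_smul_apply, coeff_funToAlg_mul,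
    irr_convolution]
  split_ifs with h
  · subst h
    rw [MonoidAlgebra.coeff_smul_apply, coeff_funToAlg, hχ1, smul_eq_mul, smul_eq_mul]
    field_simp
  · simp

theorem irrElt_ne_zero [Finite G] (χ : Irr G) : irrElt χ ≠ 0 := by
  have hcard : (Nat.card G : ℂ) ≠ 0 := by exact_mod_cast Nat.card_pos.ne'
  obtain ⟨n, hn, hχ1⟩ := χ.2.exists_nat
  have hn' : (n : ℂ) ≠ 0 := by exact_mod_cast hn.ne'
  intro h
  have := congrArg (fun x => x.coeff 1) h
  simp only [irrElt, MonoidAlgebra.coeff_smul_apply, coeff_funToAlg, hχ1] at this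
  exact mul_ne_zero (div_ne_zero hn' hcard) hn' this

theorem linearIndependent_of_orthogonal {R ι : Type*} [DecidableEq ι] [Ring R] [Algebra ℂ R] (e : ι → R)
    (he : ∀ i j, e i * e j = if i = j then e i else 0) (h0 : ∀ i, e i ≠ 0) :
    LinearIndependent ℂ e := by
  rw [linearIndependent_iff']
  intro s a hs i hi
  have := congrArg (fun x => x * e i) hs
  simp only [Finset.sum_mul, smul_mul_assoc, he, smul_ite, smul_zero, zero_mul,
    Finset.sum_ite_eq', hi, if_true] at this
  exact (smul_eq_zero.1 this).resolve_right (h0 i)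

instance finiteDimensional_groupAlgebra [Finite G] : FiniteDimensional ℂ ℂ[G] :=
  Module.Finite.of_surjective funToAlg fun x => ⟨x.coeff, by ext; rfl⟩

open Classical in
instance finite_irr [Finite G] : Finite (Irr G) :=
  (linearIndependent_of_orthogonal irrElt irrElt_mul irrElt_ne_zero).finite

/-- The class function `σ_X = ∑_{χ ∈ X} χ(1) χ` attached to a set `X` of irreducible
characters. -/
def sigmaChar [Finite G] (X : Set (Irr G)) (g : G) : ℂ :=
  ∑ χ ∈ X.toFinite.toFinset, χ.1 1 * χ.1 g

end Characters

/-- A supercharacter theory `(𝒳, 𝒦)` of a finite group `G`. The partition `𝒦` of the set of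
conjugacy classes is recorded as the partition of `G` into the unions of its blocks. -/
structure SupercharacterTheory (G : Type u) [Group G] [Finite G] where
  /-- The partition `𝒳` of `Irr(G)`. -/
  charBlocks : Set (Set (Irr G))
  /-- The partition `𝒦`, whose members are the superclasses. -/
  superclasses : Set (Set G)
  isPartition_charBlocks : Setoid.IsPartition charBlocks
  isPartition_superclasses : Setoid.IsPartition superclasses
  conj_mem : ∀ K ∈ superclasses, ∀ g ∈ K, ∀ h : G, h * g * h⁻¹ ∈ K
  one_mem : {1} ∈ superclasses
  triv_mem : {trivIrr G} ∈ charBlocks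
  card_eq : Nat.card superclasses = Nat.card charBlocks
  sigma_const : ∀ X ∈ charBlocks, ∀ K ∈ superclasses, ∀ g ∈ K, ∀ h ∈ K,
    sigmaChar X g = sigmaChar X h

namespace SupercharacterTheory

section

variable {G : Type u} [Group G] [Finite G] (A : SupercharacterTheory G)

/-- The linear subspace of `ℂ[G]` spanned by the superclass sums. -/
def space : Submodule ℂ ℂ[G] :=
  Submodule.span ℂ (Set.range fun K : A.superclasses => setSum K.1)

theorem nonempty_superclass (K : A.superclasses) : K.1.Nonempty :=
  Setoid.nonempty_of_mem_partition A.isPartition_superclasses K.2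

/-- The supercharacter table: rows are indexed by the blocks `X` of characters (equivalently by the
supercharacters `σ_X`), columns by the superclasses `K`, and the `(X, K)` entry is the constant
value of `σ_X` on `K`. -/
def table : Matrix A.charBlocks A.superclasses ℂ :=
  fun X K => sigmaChar X.1 (A.nonempty_superclass K).some

theorem table_eq (X : A.charBlocks) (K : A.superclasses) {g : G} (hg : g ∈ K.1) :
    A.table X K = sigmaChar X.1 g :=
  A.sigma_const X.1 X.2 K.1 K.2 _ (A.nonempty_superclass K).some_mem _ hg

theorem mem_space_of_const (x : ℂ[G])
    (hx : ∀ K ∈ A.superclasses, ∀ g ∈ K, ∀ h ∈ K, x.coeff g = x.coeff h) : x ∈ A.space := by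
  classical
  cases nonempty_fintype A.superclasses
  have : x = ∑ K : A.superclasses,
      x.coeff (A.nonempty_superclass K).some • setSum K.1 := by
    ext g
    obtain ⟨K, ⟨hK, hgK⟩, huniq⟩ := A.isPartition_superclasses.2 g
    rw [MonoidAlgebra.coeff_sum, Finsupp.finsetSum_apply, Finset.sum_eq_single ⟨K, hK⟩]
    · rw [MonoidAlgebra.coeff_smul_apply, coeff_setSum, if_pos hgK, smul_eq_mul, mul_one]
      exact hx K hK _ hgK _ (A.nonempty_superclass ⟨K, hK⟩).some_mem
    · intro L _ hL
      rw [MonoidAlgebra.coeff_smul_apply, coeff_setSum, if_neg, smul_zero]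
      exact fun h => hL (Subtype.ext (huniq L.1 ⟨L.2, h⟩))
    · simp
  rw [this]
  exact Submodule.sum_mem _ fun K _ =>
    Submodule.smul_mem _ _ (Submodule.subset_span ⟨K, rfl⟩)

theorem const_of_mem_space {x : ℂ[G]} (hx : x ∈ A.space) :
    ∀ K ∈ A.superclasses, ∀ g ∈ K, ∀ h ∈ K, x.coeff g = x.coeff h := by
  intro K hK g hg h hh
  induction hx using Submodule.span_induction with
  | mem x hx =>
    classical
    obtain ⟨L, rfl⟩ := hx
    simp only [coeff_setSum]
    have : ∀ k ∈ K, (k ∈ L.1 ↔ K = L.1) := fun k hk =>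
      ⟨fun h => (A.isPartition_superclasses.2 k).unique ⟨hK, hk⟩ ⟨L.2, h⟩, fun h => h ▸ hk⟩
    simp only [this g hg, this h hh]
  | zero => rfl
  | add x y _ _ hx hy => simp [hx, hy]
  | smul c x _ hx => simp [hx]

theorem hadamard_mem {x y : ℂ[G]} (hx : x ∈ A.space) (hy : y ∈ A.space) :
    hadamardProd x y ∈ A.space :=
  A.mem_space_of_const _ fun K hK g hg h hh => by
    rw [coeff_hadamardProd, coeff_hadamardProd, A.const_of_mem_space hx K hK g hg h hh,
      A.const_of_mem_space hy K hK g hg h hh]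

/-- The element `(1/|G|) ∑_g σ_X(g) g`. -/
def blockElt (X : A.charBlocks) : ℂ[G] :=
  ∑ χ ∈ X.1.toFinite.toFinset, irrElt χ

theorem blockElt_mem (X : A.charBlocks) : A.blockElt X ∈ A.space := by
  have h : ∀ g, (A.blockElt X).coeff g = (Nat.card G : ℂ)⁻¹ * sigmaChar X.1 g := by
    intro g
    simp only [blockElt, sigmaChar, MonoidAlgebra.coeff_sum, Finsupp.finsetSum_apply, irrElt,
      MonoidAlgebra.coeff_smul_apply, coeff_funToAlg, Finset.mul_sum, smul_eq_mul]
    exact Finset.sum_congr rfl fun χ _ => by ring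
  exact A.mem_space_of_const _ fun K hK g hg k hk => by
    rw [h, h, A.sigma_const X.1 X.2 K hK g hg k hk]

open Classical in
theorem irrElt_mul_blockElt (χ : Irr G) (X : A.charBlocks) :
    irrElt χ * A.blockElt X = if χ ∈ X.1 then irrElt χ else 0 := by
  simp [blockElt, Finset.mul_sum, irrElt_mul]

open Classical in
theorem blockElt_mul (X Y : A.charBlocks) :
    A.blockElt X * A.blockElt Y = if X = Y then A.blockElt X else 0 := by
  conv_lhs => rw [blockElt, Finset.sum_mul]
  simp only [irrElt_mul_blockElt]
  have : ∀ χ ∈ X.1, (χ ∈ Y.1 ↔ X = Y) := fun χ hχ =>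
    ⟨fun h => Subtype.ext
      ((A.isPartition_charBlocks.2 χ).unique ⟨X.2, hχ⟩ ⟨Y.2, h⟩), fun h => h ▸ hχ⟩
  rw [Finset.sum_congr rfl (g := fun χ => if X = Y then irrElt χ else 0)]
  · split_ifs <;> simp [blockElt]
  · intro χ hχ
    simp only [this χ (by simpa using hχ)]

theorem blockElt_ne_zero (X : A.charBlocks) : A.blockElt X ≠ 0 := by
  classical
  obtain ⟨χ, hχ⟩ := Setoid.nonempty_of_mem_partition A.isPartition_charBlocks X.2
  intro h
  have := A.irrElt_mul_blockElt χ X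
  rw [h, if_pos hχ, mul_zero] at this
  exact irrElt_ne_zero χ this.symm

theorem span_blockElt : Submodule.span ℂ (Set.range A.blockElt) = A.space := by
  classical
  cases nonempty_fintype A.superclasses
  cases nonempty_fintype A.charBlocks
  refine Submodule.eq_of_le_of_finrank_le
    (Submodule.span_le.2 (Set.range_subset_iff.2 A.blockElt_mem)) ?_
  rw [finrank_span_eq_card
    (linearIndependent_of_orthogonal A.blockElt A.blockElt_mul A.blockElt_ne_zero),
    ← Nat.card_eq_fintype_card, ← A.card_eq, Nat.card_eq_fintype_card]
  exact finrank_range_le_card _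

theorem mul_mem {x y : ℂ[G]} (hx : x ∈ A.space) (hy : y ∈ A.space) : x * y ∈ A.space := by
  classical
  rw [← span_blockElt] at hx hy
  induction hx, hy using Submodule.span_induction₂ with
  | mem_mem x y hx hy =>
    obtain ⟨X, rfl⟩ := hx
    obtain ⟨Y, rfl⟩ := hy
    rw [A.blockElt_mul]
    split_ifs
    · exact A.blockElt_mem X
    · exact A.space.zero_mem
  | zero_left y _ => rw [zero_mul]; exact A.space.zero_mem
  | zero_right x _ => rw [mul_zero]; exact A.space.zero_mem
  | add_left x y z _ _ _ h1 h2 => rw [add_mul]; exact A.space.add_mem h1 h2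
  | add_right x y z _ _ _ h1 h2 => rw [mul_add]; exact A.space.add_mem h1 h2
  | smul_left r x y _ _ h => rw [smul_mul_assoc]; exact A.space.smul_mem _ h
  | smul_right r x y _ _ h => rw [mul_smul_comm]; exact A.space.smul_mem _ h

end

section

variable {G : Type u} {H : Type v} [Group G] [Finite G] [Group H] [Finite H]

/-- A linear map between the algebras of two supercharacter theories is a homomorphism of
supercharacter theories if it preserves the ordinary product and the Hadamard product. -/
structure IsHom (A : SupercharacterTheory G) (B : SupercharacterTheory H)
    (φ : A.space →ₗ[ℂ] B.space) : Prop where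
  map_mul : ∀ x y : A.space,
    (φ ⟨x.1 * y.1, A.mul_mem x.2 y.2⟩ : ℂ[H]) = (φ x : ℂ[H]) * (φ y : ℂ[H])
  map_hadamard : ∀ x y : A.space,
    (φ ⟨hadamardProd x.1 y.1, A.hadamard_mem x.2 y.2⟩ : ℂ[H]) =
      hadamardProd (φ x : ℂ[H]) (φ y : ℂ[H])

end

end SupercharacterTheory

end

/-!
The algebra of a supercharacter theory of `G` has two distinguished bases: the superclass sums
`s_K = ∑ g ∈ K, g`, which are orthogonal idempotents for the Hadamard product, and the elements
`e_X = |G|⁻¹ ∑ g, σ_X(g) g`, which are orthogonal idempotents for the ordinary product. A linear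
isomorphism respects a product exactly when it permutes the corresponding basis of orthogonal
idempotents. Since the `s_K`-coordinate of `e_X` is `|G|⁻¹ σ_X(K)`, respecting both products amounts
to an equality, up to permutations, of the tables scaled by `|G|⁻¹` and `|H|⁻¹`. The scalars agree
because each product has a unit: `∑ X, e_X` is the class sum of `{1}`, while `∑ K, s_K` is `|G|`
times `e_X` for `X` the block of the trivial character.
-/

open Module

section Bases

variable {R V W ι κ : Type*} [CommSemiring R] [AddCommMonoid V] [Module R V]
  [AddCommMonoid W] [Module R W]

theorem eq_of_basis_repr_apply_eq [Nontrivial R] (b : Basis ι R V) {i j : ι}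
    (h : ∀ x, b.repr x i = b.repr x j) : i = j := by
  have hj := h (b j)
  rw [b.repr_self, Finsupp.single_eq_same] at hj
  exact (Finsupp.single_apply_ne_zero.1 (hj ▸ one_ne_zero)).1

theorem basis_repr_equiv_apply (b : Basis ι R V) (b' : Basis κ R W) (e : ι ≃ κ) (x : V)
    (i : ι) : b'.repr (b.equiv b' e x) (e i) = b.repr x i := by
  have hcoord : b'.coord (e i) ∘ₗ (b.equiv b' e).toLinearMap = b.coord i := b.ext fun j => by
    classical simp [Finsupp.single_apply]
  exact LinearMap.congr_fun hcoord x

theorem basis_equiv_eq_basis_equiv_iff {ι' κ' : Type*} (b : Basis ι R V) (b' : Basis ι' R W)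
    (d : Basis κ R V) (d' : Basis κ' R W) (r : ι ≃ ι') (c : κ ≃ κ') :
    b.equiv b' r = d.equiv d' c ↔ ∀ i k, d.repr (b i) k = d'.repr (b' (r i)) (c k) := by
  refine ⟨fun h i k => ?_, fun h => b.ext' fun i => d'.ext_elem fun k => ?_⟩
  · rw [← basis_repr_equiv_apply d d' c, ← h, b.equiv_apply]
  · obtain ⟨k, rfl⟩ := c.surjective k
    rw [basis_repr_equiv_apply, b.equiv_apply, h]

theorem eq_of_smul_basis_eq_smul_basis {s t : R} (b : Basis ι R V) {i j : ι} (hs : s ≠ 0)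
    (h : s • b i = t • b j) : s = t := by
  classical
  have hi := DFunLike.congr_fun (congrArg b.repr h) i
  simp only [map_smul, b.repr_self, Finsupp.smul_apply, Finsupp.single_apply, smul_eq_mul,
    mul_ite, if_true, mul_one, mul_zero] at hi
  split_ifs at hi with hji
  · exact hi
  · exact absurd hi hs

end Bases

section IdempotentBasis

variable {R V W ι κ : Type*} [CommSemiring R] [AddCommMonoid V] [Module R V]
  [AddCommMonoid W] [Module R W] {m : V →ₗ[R] V →ₗ[R] V} {m' : W →ₗ[R] W →ₗ[R] W}
  {b : Basis ι R V} {b' : Basis κ R W}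

/-- The vectors of the basis `b` are orthogonal idempotents for the bilinear product `m`, so that
`m` is the coordinatewise product. The product is a bilinear map rather than a ring structure
because the algebra of a supercharacter theory carries two products. -/
structure IsIdempotentBasis (m : V →ₗ[R] V →ₗ[R] V) (b : Basis ι R V) : Prop where
  idem : ∀ i, m (b i) (b i) = b i
  ortho : Pairwise fun i j => m (b i) (b j) = 0

namespace IsIdempotentBasis

theorem mul_apply [DecidableEq ι] (hb : IsIdempotentBasis m b) (i j : ι) :
    m (b i) (b j) = if i = j then b i else 0 := by
  split_ifs with hij
  · rw [← hij, hb.idem]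
  · exact hb.ortho hij

theorem repr_mul (hb : IsIdempotentBasis m b) (x y : V) (i : ι) :
    b.repr (m x y) i = b.repr x i * b.repr y i := by
  classical
  have hbilin : m.compr₂ (b.coord i) = (LinearMap.mul R R).compl₁₂ (b.coord i) (b.coord i) :=
    b.ext fun j => b.ext fun k => by
      by_cases hjk : j = k <;> by_cases hji : j = i <;>
        simp_all [hb.mul_apply, Finsupp.single_apply]
  exact LinearMap.congr_fun₂ hbilin x y

theorem sum_eq_of_mul_right_eq_self [Fintype ι] (hb : IsIdempotentBasis m b) {u : V}
    (hu : ∀ x, m x u = x) : ∑ i, b i = u := by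
  classical
  have hleft : m (∑ i, b i) = LinearMap.id := b.ext fun j => by
    simp [LinearMap.sum_apply, hb.mul_apply]
  rw [← hu (∑ i, b i), hleft, LinearMap.id_apply]

/-- A nonzero multiplicative functional `f` satisfies `f (b i) ^ 2 = f (b i)` and
`f (b i) * f (b j) = 0`, so it is `1` on exactly one basis vector and `0` on the others. -/
theorem exists_eq_coord [IsCancelMulZero R] (hb : IsIdempotentBasis m b) {f : V →ₗ[R] R}
    (hf : ∀ x y, f (m x y) = f x * f y) (hf0 : f ≠ 0) : ∃ i, f = b.coord i := by
  classical
  obtain ⟨i, hi⟩ : ∃ i, f (b i) ≠ 0 := by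
    by_contra! h
    exact hf0 (b.ext h)
  have hi1 : f (b i) = 1 := (mul_eq_left₀ hi).1 (by rw [← hf, hb.idem])
  refine ⟨i, b.ext fun j => ?_⟩
  rw [Basis.coord_apply, Basis.repr_self, Finsupp.single_apply]
  split_ifs with hji
  · rw [hji, hi1]
  · rw [← mul_one (f (b j)), ← hi1, ← hf, hb.ortho hji, map_zero]

theorem exists_repr_apply_eq [IsCancelMulZero R] [Nontrivial R] (hb : IsIdempotentBasis m b)
    (hb' : IsIdempotentBasis m' b') (φ : V ≃ₗ[R] W) (hφ : ∀ x y, φ (m x y) = m' (φ x) (φ y))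
    (k : κ) : ∃ i, ∀ x, b'.repr (φ x) k = b.repr x i := by
  have hne : b'.coord k ∘ₗ φ.toLinearMap ≠ 0 := fun h => by
    simpa using LinearMap.congr_fun h (φ.symm (b' k))
  obtain ⟨i, hi⟩ := hb.exists_eq_coord (f := b'.coord k ∘ₗ φ.toLinearMap)
    (fun x y => by simp [hφ, hb'.repr_mul]) hne
  exact ⟨i, LinearMap.congr_fun hi⟩

theorem exists_eq_equiv [IsCancelMulZero R] [Nontrivial R] (hb : IsIdempotentBasis m b)
    (hb' : IsIdempotentBasis m' b') (φ : V ≃ₗ[R] W) (hφ : ∀ x y, φ (m x y) = m' (φ x) (φ y)) :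
    ∃ e : ι ≃ κ, φ = b.equiv b' e := by
  have hφsymm (x y) : φ.symm (m' x y) = m (φ.symm x) (φ.symm y) := φ.injective (by simp [hφ])
  choose σ hσ using hb.exists_repr_apply_eq hb' φ hφ
  choose τ hτ using hb'.exists_repr_apply_eq hb φ.symm hφsymm
  have hστ (i) : σ (τ i) = i := eq_of_basis_repr_apply_eq b fun x => by
    rw [← hσ, ← hτ, φ.symm_apply_apply]
  have hτσ (k) : τ (σ k) = k := eq_of_basis_repr_apply_eq b' fun x => by
    rw [← hτ, ← hσ, φ.apply_symm_apply]
  let e : ι ≃ κ := ⟨τ, σ, hστ, hτσ⟩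
  refine ⟨e, b.ext' fun i => b'.ext_elem fun k => ?_⟩
  obtain ⟨j, rfl⟩ := e.surjective k
  have hσe : σ (e j) = j := hστ j
  rw [hσ, hσe, b.equiv_apply, b.repr_self, b'.repr_self, Finsupp.single_apply_left e.injective]

theorem map_mul_iff_exists_eq_equiv [IsCancelMulZero R] [Nontrivial R]
    (hb : IsIdempotentBasis m b) (hb' : IsIdempotentBasis m' b') (φ : V ≃ₗ[R] W) :
    (∀ x y, φ (m x y) = m' (φ x) (φ y)) ↔ ∃ e : ι ≃ κ, φ = b.equiv b' e := by
  refine ⟨hb.exists_eq_equiv hb' φ, ?_⟩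
  rintro ⟨e, rfl⟩
  classical
  have hbilin : m.compr₂ (b.equiv b' e).toLinearMap =
      m'.compl₁₂ (b.equiv b' e).toLinearMap (b.equiv b' e).toLinearMap :=
    b.ext fun i => b.ext fun j => by
      by_cases hij : i = j <;> simp [hb.mul_apply, hb'.mul_apply, hij]
  exact LinearMap.congr_fun₂ hbilin

end IsIdempotentBasis

end IdempotentBasis

namespace SupercharacterTheory

section Bases

variable {G : Type u} [Group G] [Finite G] (A : SupercharacterTheory G)

open Classical in
theorem coeff_setSum_superclass (K L : A.superclasses) {g : G} (hg : g ∈ L.1) :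
    (setSum K.1).coeff g = if K = L then 1 else 0 := by
  rw [coeff_setSum]
  refine if_congr ⟨fun h => Subtype.ext ?_, fun h => h ▸ hg⟩ rfl rfl
  exact (A.isPartition_superclasses.2 g).unique ⟨K.2, h⟩ ⟨L.2, hg⟩

theorem linearIndependent_setSum :
    LinearIndependent ℂ fun K : A.superclasses => setSum K.1 := by
  classical
  refine .of_pairwise_dual_eq_zero_one _
    (fun K => (MonoidAlgebra.basis G ℂ).coord (A.nonempty_superclass K).some)
    (fun K L hKL => ?_) (fun K => ?_)
  · exact (A.coeff_setSum_superclass L K (A.nonempty_superclass K).some_mem).trans (if_neg hKL.symm)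
  · exact (A.coeff_setSum_superclass K K (A.nonempty_superclass K).some_mem).trans (if_pos rfl)

/-- The basis of superclass sums of the algebra of a supercharacter theory. -/
noncomputable def classBasis : Basis A.superclasses ℂ A.space :=
  .span A.linearIndependent_setSum

theorem coe_classBasis (K : A.superclasses) : (A.classBasis K : ℂ[G]) = setSum K.1 :=
  congrArg Subtype.val (Basis.span_apply A.linearIndependent_setSum K)

theorem classBasis_repr (x : A.space) (K : A.superclasses) {g : G} (hg : g ∈ K.1) :
    A.classBasis.repr x K = x.1.coeff g := by
  classical
  have hcoord : A.classBasis.coord K = (MonoidAlgebra.basis G ℂ).coord g ∘ₗ A.space.subtype :=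
    A.classBasis.ext fun L => by
      rw [Basis.coord_apply, Basis.repr_self, Finsupp.single_apply, LinearMap.comp_apply,
        Submodule.subtype_apply, coe_classBasis]
      exact (A.coeff_setSum_superclass L K hg).symm
  exact LinearMap.congr_fun hcoord x

/-- The basis `e_X = |G|⁻¹ ∑ g, σ_X(g) g` of the algebra of a supercharacter theory. -/
noncomputable def blockBasis : Basis A.charBlocks ℂ A.space := by
  classical
  exact (Basis.span (linearIndependent_of_orthogonal A.blockElt A.blockElt_mul
    A.blockElt_ne_zero)).map (LinearEquiv.ofEq _ _ A.span_blockElt)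

theorem coe_blockBasis (X : A.charBlocks) : (A.blockBasis X : ℂ[G]) = A.blockElt X := by
  rw [blockBasis, Basis.map_apply, LinearEquiv.coe_ofEq_apply, Basis.span_apply]

theorem coeff_blockElt (X : A.charBlocks) (g : G) :
    (A.blockElt X).coeff g = (Nat.card G : ℂ)⁻¹ * sigmaChar X.1 g := by
  simp only [blockElt, sigmaChar, MonoidAlgebra.coeff_sum, Finsupp.finsetSum_apply, irrElt,
    MonoidAlgebra.coeff_smul_apply, coeff_funToAlg, Finset.mul_sum, smul_eq_mul]
  exact Finset.sum_congr rfl fun χ _ => by ring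

theorem classBasis_repr_blockBasis (X : A.charBlocks) (K : A.superclasses) :
    A.classBasis.repr (A.blockBasis X) K = (Nat.card G : ℂ)⁻¹ * A.table X K := by
  obtain ⟨g, hg⟩ := A.nonempty_superclass K
  rw [A.classBasis_repr _ K hg, coe_blockBasis, coeff_blockElt, A.table_eq X K hg]

end Bases

section Products

variable {G : Type u} [Group G] [Finite G] (A : SupercharacterTheory G)

/-- The ordinary product on the algebra of a supercharacter theory, as a bilinear map. -/
noncomputable def mulMap : A.space →ₗ[ℂ] A.space →ₗ[ℂ] A.space :=
  LinearMap.mk₂ ℂ (fun x y => ⟨x.1 * y.1, A.mul_mem x.2 y.2⟩)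
    (fun x y z => Subtype.ext (add_mul x.1 y.1 z.1))
    (fun a x y => Subtype.ext (smul_mul_assoc a x.1 y.1))
    (fun x y z => Subtype.ext (mul_add x.1 y.1 z.1))
    (fun a x y => Subtype.ext (mul_smul_comm a x.1 y.1))

/-- The Hadamard product on the algebra of a supercharacter theory, as a bilinear map. -/
noncomputable def hadamardMap : A.space →ₗ[ℂ] A.space →ₗ[ℂ] A.space :=
  LinearMap.mk₂ ℂ (fun x y => ⟨hadamardProd x.1 y.1, A.hadamard_mem x.2 y.2⟩)
    (fun x y z => by ext g; simp [coeff_hadamardProd, add_mul])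
    (fun a x y => by ext g; simp [coeff_hadamardProd, mul_assoc])
    (fun x y z => by ext g; simp [coeff_hadamardProd, mul_add])
    (fun a x y => by ext g; simp [coeff_hadamardProd, mul_left_comm])

theorem coe_mulMap (x y : A.space) : (A.mulMap x y : ℂ[G]) = x * y := rfl

theorem coe_hadamardMap (x y : A.space) :
    (A.hadamardMap x y : ℂ[G]) = hadamardProd (x : ℂ[G]) y := rfl

theorem isIdempotentBasis_blockBasis : IsIdempotentBasis A.mulMap A.blockBasis where
  idem X := Subtype.ext (by simp [coe_mulMap, coe_blockBasis, blockElt_mul])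
  ortho X Y hXY := Subtype.ext (by simp [coe_mulMap, coe_blockBasis, blockElt_mul, hXY])

theorem classBasis_repr_hadamardMap (x y : A.space) (K : A.superclasses) :
    A.classBasis.repr (A.hadamardMap x y) K =
      A.classBasis.repr x K * A.classBasis.repr y K := by
  obtain ⟨g, hg⟩ := A.nonempty_superclass K
  simp only [A.classBasis_repr _ K hg, coe_hadamardMap, coeff_hadamardProd]

theorem isIdempotentBasis_classBasis : IsIdempotentBasis A.hadamardMap A.classBasis where
  idem K := A.classBasis.ext_elem fun L => by
    classical simp [classBasis_repr_hadamardMap, Finsupp.single_apply]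
  ortho K L hKL := A.classBasis.ext_elem fun M => by
    classical
    by_cases hKM : K = M <;> simp_all [classBasis_repr_hadamardMap, Finsupp.single_apply, eq_comm]

theorem coe_classBasis_one : (A.classBasis ⟨{1}, A.one_mem⟩ : ℂ[G]) = 1 := by
  classical
  ext g
  simp [coe_classBasis, coeff_setSum, MonoidAlgebra.one_def, Finsupp.single_apply, eq_comm]

theorem sum_blockBasis [Fintype A.charBlocks] :
    ∑ X, A.blockBasis X = A.classBasis ⟨{1}, A.one_mem⟩ :=
  A.isIdempotentBasis_blockBasis.sum_eq_of_mul_right_eq_self fun x => Subtype.ext (by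
    rw [coe_mulMap, coe_classBasis_one, mul_one])

theorem table_trivIrr (K : A.superclasses) : A.table ⟨{trivIrr G}, A.triv_mem⟩ K = 1 := by
  simp [table, sigmaChar, trivIrr]

theorem sum_classBasis [Fintype A.superclasses] :
    ∑ K, A.classBasis K = (Nat.card G : ℂ) • A.blockBasis ⟨{trivIrr G}, A.triv_mem⟩ := by
  refine A.isIdempotentBasis_classBasis.sum_eq_of_mul_right_eq_self fun x =>
    A.classBasis.ext_elem fun K => ?_
  have hG : (Nat.card G : ℂ) ≠ 0 := Nat.cast_ne_zero.2 Nat.card_pos.ne'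
  rw [classBasis_repr_hadamardMap, map_smul, Finsupp.smul_apply, classBasis_repr_blockBasis,
    table_trivIrr, mul_one, smul_eq_mul, mul_inv_cancel₀ hG, mul_one]

end Products

section Isomorphisms

variable {G : Type u} {H : Type v} [Group G] [Finite G] [Group H] [Finite H]
  {A : SupercharacterTheory G} {B : SupercharacterTheory H}

theorem isHom_iff_exists_eq_equiv (φ : A.space ≃ₗ[ℂ] B.space) :
    A.IsHom B φ.toLinearMap ↔
      (∃ r, φ = A.blockBasis.equiv B.blockBasis r) ∧
        ∃ c, φ = A.classBasis.equiv B.classBasis c := by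
  rw [← A.isIdempotentBasis_blockBasis.map_mul_iff_exists_eq_equiv B.isIdempotentBasis_blockBasis,
    ← A.isIdempotentBasis_classBasis.map_mul_iff_exists_eq_equiv B.isIdempotentBasis_classBasis]
  exact ⟨fun h => ⟨fun x y => Subtype.ext (h.map_mul x y),
      fun x y => Subtype.ext (h.map_hadamard x y)⟩,
    fun h => ⟨fun x y => congrArg Subtype.val (h.1 x y),
      fun x y => congrArg Subtype.val (h.2 x y)⟩⟩

variable (r : A.charBlocks ≃ B.charBlocks) (c : A.superclasses ≃ B.superclasses)

/-- Apply the isomorphism to `∑ K, s_K = |G| e_X`, where `X` is the block of the trivial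
character. -/
theorem card_eq_of_equiv_eq
    (h : A.blockBasis.equiv B.blockBasis r = A.classBasis.equiv B.classBasis c) :
    Nat.card G = Nat.card H := by
  cases nonempty_fintype A.superclasses
  cases nonempty_fintype B.superclasses
  have hH : (Nat.card H : ℂ) ≠ 0 := Nat.cast_ne_zero.2 Nat.card_pos.ne'
  have hunit : (Nat.card H : ℂ) • B.blockBasis ⟨{trivIrr H}, B.triv_mem⟩ =
      (Nat.card G : ℂ) • B.blockBasis (r ⟨{trivIrr G}, A.triv_mem⟩) :=
    calc
      _ = ∑ L, B.classBasis L := B.sum_classBasis.symm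
      _ = ∑ K, A.classBasis.equiv B.classBasis c (A.classBasis K) := by
        simp only [Basis.equiv_apply, c.sum_comp fun L => B.classBasis L]
      _ = _ := by rw [← map_sum, A.sum_classBasis, map_smul, ← h, Basis.equiv_apply]
  exact_mod_cast (eq_of_smul_basis_eq_smul_basis B.blockBasis hH hunit).symm

/-- The linear map `s_K ↦ s_(c K)` sends `|G| e_X` to `|H| e_(r X)`. Summing over `X`, it sends
`|G| 1` both to `|G|` times a class sum and to `|H| 1`. -/
theorem card_eq_of_table_eq (h : ∀ X K, A.table X K = B.table (r X) (c K)) :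
    Nat.card G = Nat.card H := by
  cases nonempty_fintype A.charBlocks
  cases nonempty_fintype B.charBlocks
  have hG : (Nat.card G : ℂ) ≠ 0 := Nat.cast_ne_zero.2 Nat.card_pos.ne'
  have hH : (Nat.card H : ℂ) ≠ 0 := Nat.cast_ne_zero.2 Nat.card_pos.ne'
  have hblock (X) : (Nat.card G : ℂ) • A.classBasis.equiv B.classBasis c (A.blockBasis X) =
      (Nat.card H : ℂ) • B.blockBasis (r X) := by
    refine B.classBasis.ext_elem fun L => ?_
    obtain ⟨K, rfl⟩ := c.surjective L
    simp only [map_smul, Finsupp.smul_apply, basis_repr_equiv_apply, classBasis_repr_blockBasis,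
      smul_eq_mul, mul_inv_cancel_left₀ hG, mul_inv_cancel_left₀ hH, h]
  have hunit : (Nat.card G : ℂ) • B.classBasis (c ⟨{1}, A.one_mem⟩) =
      (Nat.card H : ℂ) • B.classBasis ⟨{1}, B.one_mem⟩ :=
    calc
      _ = ∑ X, (Nat.card G : ℂ) • A.classBasis.equiv B.classBasis c (A.blockBasis X) := by
        rw [← Finset.smul_sum, ← map_sum, A.sum_blockBasis, Basis.equiv_apply]
      _ = ∑ X, (Nat.card H : ℂ) • B.blockBasis (r X) := Fintype.sum_congr _ _ hblock
      _ = _ := by rw [← Finset.smul_sum, r.sum_comp fun Y => B.blockBasis Y, B.sum_blockBasis]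
  exact_mod_cast eq_of_smul_basis_eq_smul_basis B.classBasis hG hunit

theorem equiv_eq_iff_table_eq :
    A.blockBasis.equiv B.blockBasis r = A.classBasis.equiv B.classBasis c ↔
      ∀ X K, A.table X K = B.table (r X) (c K) := by
  have hG : (Nat.card G : ℂ) ≠ 0 := Nat.cast_ne_zero.2 Nat.card_pos.ne'
  have iff_of_card_eq (hcard : Nat.card G = Nat.card H) :
      A.blockBasis.equiv B.blockBasis r = A.classBasis.equiv B.classBasis c ↔
        ∀ X K, A.table X K = B.table (r X) (c K) := by
    simp only [basis_equiv_eq_basis_equiv_iff, classBasis_repr_blockBasis, ← hcard,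
      mul_right_inj' (inv_ne_zero hG)]
  exact ⟨fun h => (iff_of_card_eq (card_eq_of_equiv_eq r c h)).1 h,
    fun h => (iff_of_card_eq (card_eq_of_table_eq r c h)).2 h⟩

end Isomorphisms

end SupercharacterTheory

theorem mainTheorem2 {G : Type u} {H : Type v} [Group G] [Finite G] [Group H] [Finite H]
    (A : SupercharacterTheory G) (B : SupercharacterTheory H) :
    (∃ φ : A.space →ₗ[ℂ] B.space, A.IsHom B φ ∧ Function.Bijective φ) ↔
      ∃ (r : A.charBlocks ≃ B.charBlocks) (c : A.superclasses ≃ B.superclasses),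
        ∀ X K, A.table X K = B.table (r X) (c K) := by
  constructor
  · rintro ⟨φ, hφ, hbij⟩
    obtain ⟨⟨r, hr⟩, c, hc⟩ :=
      (SupercharacterTheory.isHom_iff_exists_eq_equiv (LinearEquiv.ofBijective φ hbij)).1 hφ
    exact ⟨r, c, (SupercharacterTheory.equiv_eq_iff_table_eq r c).1 (hr.symm.trans hc)⟩
  · rintro ⟨r, c, htable⟩
    have heq := (SupercharacterTheory.equiv_eq_iff_table_eq r c).2 htable
    exact ⟨_, (SupercharacterTheory.isHom_iff_exists_eq_equiv (A.classBasis.equiv B.classBasis c)).2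
      ⟨⟨r, heq.symm⟩, c, rfl⟩, (A.classBasis.equiv B.classBasis c).bijective⟩
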